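/- All directed graphs are finite and may have parallel edges. For a vertex $v$ of a directed graph, $I(v)$ and $O(v)$ denote its sets of incoming and outgoing edges; $v$ is a source if $I(v)=\emptyset$ and a sink if $O(v)=\emptyset$. For a directed graph $H$, $V(H)$, $E(H)$, $S(H)$, $T(H)$ denote its sets of vertices, edges, sources and sinks; $I(H)$ (resp. $O(H)$) is the set of edges of $H$ that start at a source (resp. end at a sink); $s(e)$ and $t(e)$ are the starting and the end vertex of an edge $e$. An upward planar graph is a crossing-free drawing in $\mathbb{R}^2$ of an acyclic directed graph in which every edge $e$ is a continuous curve from $s(e)$ to $t(e)$ whose vertical coordinate increases strictly. A progressive plane graph is an upward planar graph in which every source and every sink has degree one, and which is contained in a box $[a,b]\times[c,d]$ with $a<b$, $c<d$, such that all sources lie on the bottom side $y=c$ and all sinks on the top side $y=d$. (With the opposite vertical convention everything is reflected in a horizontal line.) In such a drawing $O(v)$ and $I(v)$ are linearly ordered from left to right, by the position of the edges just above, respectively just below, $v$; this is the polarization. For a nonempty finite linearly ordered set $X$ write $X^-=\min X$ and $X^+=\max X$. Proposition. Let $G$ be an upward planar graph. Then there exist a progressive plane graph $\Gamma$ and an embedding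 $\phi=(\phi_0,\phi_1)\colon G\to\Gamma$ (that is, injective maps $\phi_0\colon V(G)\to V(\Gamma)$ and $\phi_1\colon E(G)\to E(\Gamma)$ compatible with $s$ and $t$, such that the drawing of $\Gamma$ restricted to $\phi(G)$ is the drawing of $G$) such that (1) $\phi_0(V(G))=V(\Gamma)\setminus(S(\Gamma)\cup T(\Gamma))$; (2) $|E(\Gamma)|=|E(G)|+|S(G)|+|T(G)|$; (3) $I(\phi_0(v))\cap O(\phi_0(w))=\emptyset$ for all $v\in S(G)$ and $w\in T(G)$; (4) for every $e\in E(\Gamma)\setminus(\phi_1(E(G))\cup I(\Gamma)\cup O(\Gamma))$, either $O(s(e))^-<e<O(s(e))^+$ or $I(t(e))^-<e<I(t(e))^+$, where the linear orders are given by the polarization of $\Gamma$. -/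

import Mathlib

universe u v

/-- A directed graph with vertex set `V` and edge set `E`; parallel edges are allowed. -/
structure DirGraph (V : Type u) (E : Type v) where
  src : E → V
  tgt : E → V

namespace DirGraph

variable {V : Type*} {E : Type*} {W : Type*} {F : Type*}

/-- `I(x)`: the incoming edges of `x`. -/
def inEdges (G : DirGraph V E) (x : V) : Set E := {e | G.tgt e = x}

/-- `O(x)`: the outgoing edges of `x`. -/
def outEdges (G : DirGraph V E) (x : V) : Set E := {e | G.src e = x}

/-- `S(G)`: the vertices without incoming edges. -/
def sources (G : DirGraph V E) : Set V := {x | G.inEdges x = ∅}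

/-- `T(G)`: the vertices without outgoing edges. -/
def sinks (G : DirGraph V E) : Set V := {x | G.outEdges x = ∅}

/-- There is no directed cycle (in particular no loop). -/
def Acyclic (G : DirGraph V E) : Prop :=
  ∀ x : V, ¬ Relation.TransGen (fun a b => ∃ e, G.src e = a ∧ G.tgt e = b) x x

/-- The degree of a vertex (meant for finite graphs). -/
noncomputable def degree (G : DirGraph V E) (x : V) : ℕ :=
  (G.inEdges x).ncard + (G.outEdges x).ncard

/-- A progressive graph: acyclic, and all sources and sinks have degree one. -/
structure IsProgressive (G : DirGraph V E) : Prop where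
  acyclic : G.Acyclic
  degree_source : ∀ x ∈ G.sources, G.degree x = 1
  degree_sink : ∀ x ∈ G.sinks, G.degree x = 1

/-- `I(G)`: the edges that start from a source. -/
def inputEdges (G : DirGraph V E) : Set E := {e | G.src e ∈ G.sources}

/-- `O(G)`: the edges that end in a sink. -/
def outputEdges (G : DirGraph V E) : Set E := {e | G.tgt e ∈ G.sinks}

/-- An embedding of directed graphs: injective on vertices and on edges, compatible with the
endpoints. -/
structure Embedding (G : DirGraph V E) (H : DirGraph W F) where
  onVert : V ↪ W
  onEdge : E ↪ F
  src_onEdge : ∀ e, H.src (onEdge e) = onVert (G.src e)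
  tgt_onEdge : ∀ e, H.tgt (onEdge e) = onVert (G.tgt e)

/-- A planar embedding (drawing without crossings) of `G`: vertices are distinct points of the
plane, an edge is a simple curve from its source to its target, the open edges avoid all vertices
and are pairwise disjoint. -/
structure PlanarEmbedding (G : DirGraph V E) where
  pos : V → ℝ × ℝ
  curve : E → unitInterval → ℝ × ℝ
  pos_injective : Function.Injective pos
  continuous_curve : ∀ e, Continuous (curve e)
  curve_zero : ∀ e, curve e 0 = pos (G.src e)
  curve_one : ∀ e, curve e 1 = pos (G.tgt e)
  injOn_curve : ∀ e, Set.InjOn (curve e) (Set.Ioo 0 1)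
  curve_ne_pos : ∀ e, ∀ t ∈ Set.Ioo (0 : unitInterval) 1, ∀ x, curve e t ≠ pos x
  curve_ne_curve : ∀ e e', e ≠ e' → ∀ t ∈ Set.Ioo (0 : unitInterval) 1,
    ∀ t' ∈ Set.Ioo (0 : unitInterval) 1, curve e t ≠ curve e' t'

namespace PlanarEmbedding

variable {G : DirGraph V E}

/-- All edges increase strictly monotonically in the vertical direction. -/
def IsUpward (D : G.PlanarEmbedding) : Prop :=
  ∀ e, StrictMono fun t => (D.curve e t).2

/-- The drawing lies in a plane box `[a, b] × [c, d]`, with all sources on one horizontal side and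
all sinks on the other. As edges are drawn upward here, the sources are at the bottom. -/
def IsBoxed (D : G.PlanarEmbedding) : Prop :=
  ∃ a b c d : ℝ, a < b ∧ c < d ∧
    (∀ x, D.pos x ∈ Set.Icc a b ×ˢ Set.Icc c d) ∧
    (∀ e t, D.curve e t ∈ Set.Icc a b ×ˢ Set.Icc c d) ∧
    (∀ x ∈ G.sources, (D.pos x).2 = c) ∧
    (∀ x ∈ G.sinks, (D.pos x).2 = d)

/-- The order of the polarization on `O(x)`, for an upward drawing: `e` precedes `e'` if, just above
`x`, the edge `e` runs to the left of `e'`. -/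
def outLt (D : G.PlanarEmbedding) (x : V) (e e' : E) : Prop :=
  e ∈ G.outEdges x ∧ e' ∈ G.outEdges x ∧
    ∃ δ : ℝ, 0 < δ ∧ ∀ t t', (D.curve e t).2 = (D.curve e' t').2 →
      (D.curve e t).2 ∈ Set.Ioo (D.pos x).2 ((D.pos x).2 + δ) →
      (D.curve e t).1 < (D.curve e' t').1

/-- The order of the polarization on `I(x)`, for an upward drawing: `e` precedes `e'` if, just below
`x`, the edge `e` runs to the left of `e'`. -/
def inLt (D : G.PlanarEmbedding) (x : V) (e e' : E) : Prop :=
  e ∈ G.inEdges x ∧ e' ∈ G.inEdges x ∧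
    ∃ δ : ℝ, 0 < δ ∧ ∀ t t', (D.curve e t).2 = (D.curve e' t').2 →
      (D.curve e t).2 ∈ Set.Ioo ((D.pos x).2 - δ) (D.pos x).2 →
      (D.curve e t).1 < (D.curve e' t').1

end PlanarEmbedding

end DirGraph

/-- `X⁻ < e < X⁺`, where `X⁻` and `X⁺` are the least and the greatest element of `X` for the strict
order `lt`. -/
def StrictlyInside {E : Type*} (lt : E → E → Prop) (X : Set E) (e : E) : Prop :=
  ∃ m M, (m ∈ X ∧ ∀ f ∈ X, f ≠ m → lt m f) ∧ (M ∈ X ∧ ∀ f ∈ X, f ≠ M → lt f M) ∧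
    lt m e ∧ lt e M

/-- An upward planar graph: an upward planar embedding of an acyclic directed graph. -/
structure UpwardPlanarGraph (V : Type u) (E : Type v) where
  graph : DirGraph V E
  acyclic : graph.Acyclic
  drawing : graph.PlanarEmbedding
  upward : drawing.IsUpward

/-- A progressive plane graph: a boxed and upward planar embedding of a progressive graph. -/
structure ProgressivePlaneGraph (V : Type u) (E : Type v) where
  graph : DirGraph V E
  progressive : graph.IsProgressive
  drawing : graph.PlanarEmbedding
  upward : drawing.IsUpward
  boxed : drawing.IsBoxed

/-! An edge of an upward drawing is the graph of a continuous function of the height, so two edges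
cannot exchange their left-right order while both are drawn. Now let a path descend from a source,
where no edge arrives from below. Between consecutive vertex heights it runs in a channel between
the edges to its left and those to its right. At the next vertex height either the channel is still
open, and the path passes through at a point that is not a vertex, or a left and a right edge meet.
In that case they start at a common vertex, where the path stops strictly between two outgoing
edges. Thus the path reaches a prescribed bottom level or a vertex of this kind
(`exists_descending_path`); the path itself comes from a continuous selection
(`exists_continuous_between`).

Drawing such a path as a new edge for each source in turn, with a new bottom vertex where the level
is reached, gives the completion recorded in `DownCompletion`. Reflecting in a horizontal line and
repeating the construction treats the sinks. Each source and each sink costs exactly one edge, which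
is (2), and every added edge with no end at a new vertex leaves or enters between two others, which
is (4).

For (3), the first round creates no edge out of a sink, because its edges leave only new vertices or
vertices that already had two outgoing edges in `G`. An edge of the second round that ends at an old
vertex ends where two incoming edges were already present, whereas an original source then has
exactly one. -/

open Set Filter Topology

/-! ### Continuous selections and separation of finite sets -/

/-- A continuous function squeezed between two finite families of continuous functions on an open
interval, with prescribed values at the endpoints. At the left endpoint the two families may touch
each other in the prescribed value. -/
theorem exists_continuous_between {ι : Type*} (A B : Finset ι) (f : ι → ℝ → ℝ)
    (hf : ∀ i, Continuous (f i)) {p q x x' : ℝ} (hpq : p < q)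
    (hlt : ∀ a ∈ A, ∀ b ∈ B, ∀ y ∈ Ioo p q, f a y < f b y)
    (hA : ∀ a ∈ A, f a q < x) (hB : ∀ b ∈ B, x < f b q)
    (hp : ((∀ a ∈ A, f a p < x') ∧ ∀ b ∈ B, x' < f b p) ∨
      (∃ a ∈ A, f a p = x') ∧ (∃ b ∈ B, f b p = x') ∧ ∀ a ∈ A, ∀ b ∈ B, f a p ≤ f b p) :
    ∃ g : ℝ → ℝ, Continuous g ∧ g p = x' ∧ g q = x ∧
      ∀ y ∈ Ioo p q, (∀ a ∈ A, f a y < g y) ∧ ∀ b ∈ B, g y < f b y := by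
  -- The admissible values at each height form a convex set, so local continuous selections glue by
  -- a partition of unity.
  let t : ℝ → Set ℝ := fun y => {z | (y = p → z = x') ∧ (y = q → z = x) ∧
    (y ∈ Ioo p q → (∀ a ∈ A, f a y < z) ∧ ∀ b ∈ B, z < f b y)}
  have ht : ∀ y, Convex ℝ (t y) := by
    intro y
    apply Set.OrdConnected.convex
    refine ⟨fun z₁ h₁ z₂ h₂ z hz =>
      ⟨fun h => ?_, fun h => ?_, fun h => ⟨fun a ha => ?_, fun b hb => ?_⟩⟩⟩
    · exact le_antisymm (hz.2.trans (h₂.1 h).le) ((h₁.1 h).ge.trans hz.1)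
    · exact le_antisymm (hz.2.trans (h₂.2.1 h).le) ((h₁.2.1 h).ge.trans hz.1)
    · exact ((h₁.2.2 h).1 a ha).trans_le hz.1
    · exact hz.2.trans_lt ((h₂.2.2 h).2 b hb)
  have ev : ∀ y z : ℝ, (∀ a ∈ A, f a y < z) → (∀ b ∈ B, z < f b y) →
      ∀ᶠ u in 𝓝 y, (∀ a ∈ A, f a u < z) ∧ ∀ b ∈ B, z < f b u := by
    intro y z h₁ h₂
    refine ((Filter.eventually_all_finset A).2 fun a ha => ?_).and
      ((Filter.eventually_all_finset B).2 fun b hb => ?_)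
    · exact (hf a).continuousAt.eventually (gt_mem_nhds (h₁ a ha))
    · exact (hf b).continuousAt.eventually (lt_mem_nhds (h₂ b hb))
  have H : ∀ y : ℝ, ∃ U ∈ 𝓝 y, ∃ g : ℝ → ℝ, ContinuousOn g U ∧ ∀ u ∈ U, g u ∈ t u := by
    intro y
    have const : ∀ z : ℝ, (∀ᶠ u in 𝓝 y, z ∈ t u) →
        ∃ U ∈ 𝓝 y, ∃ g : ℝ → ℝ, ContinuousOn g U ∧ ∀ u ∈ U, g u ∈ t u :=
      fun z hz => ⟨_, hz, fun _ => z, continuousOn_const, fun _ => id⟩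
    rcases lt_trichotomy y p with hy | rfl | hy
    · refine const 0 ((gt_mem_nhds hy).mono fun u (hu : u < p) => ?_)
      exact ⟨fun h => absurd h hu.ne, fun h => absurd h (hu.trans hpq).ne,
        fun h => absurd h.1 hu.not_gt⟩
    · rcases hp with ⟨h₁, h₂⟩ | ⟨⟨a₀, ha₀, ea⟩, ⟨b₀, hb₀, eb⟩, hab⟩
      · refine const x' ?_
        filter_upwards [ev y x' h₁ h₂, gt_mem_nhds hpq] with u hu huq
        exact ⟨fun _ => rfl, fun h => absurd h huq.ne, fun _ => hu⟩
      -- The midpoint between the rightmost left function and the leftmost right function; at `p`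
      -- both extremes equal `x'`.
      · refine ⟨Iio q, Iio_mem_nhds hpq, fun u =>
          (A.sup' ⟨a₀, ha₀⟩ (f · u) + B.inf' ⟨b₀, hb₀⟩ (f · u)) / 2, ?_, ?_⟩
        · have h₁ := Continuous.finset_sup'_apply (f := f) ⟨a₀, ha₀⟩ fun i _ => hf i
          have h₂ := Continuous.finset_inf'_apply (f := f) ⟨b₀, hb₀⟩ fun i _ => hf i
          exact ((h₁.add h₂).div_const 2).continuousOn
        · intro u hu
          refine ⟨?_, fun h => absurd h (ne_of_lt hu), fun h => ?_⟩
          · rintro rfl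
            have h₁ : A.sup' ⟨a₀, ha₀⟩ (f · u) = x' := by
              apply le_antisymm
              · exact Finset.sup'_le _ _ fun a ha => eb ▸ hab a ha b₀ hb₀
              · exact ea ▸ Finset.le_sup' (f · u) ha₀
            have h₂ : B.inf' ⟨b₀, hb₀⟩ (f · u) = x' := by
              apply le_antisymm
              · exact eb ▸ Finset.inf'_le (f · u) hb₀
              · exact Finset.le_inf' _ _ fun b hb => ea ▸ hab a₀ ha₀ b hb
            simp only [h₁, h₂]
            ring
          · have key : A.sup' ⟨a₀, ha₀⟩ (f · u) < B.inf' ⟨b₀, hb₀⟩ (f · u) := by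
              exact (Finset.sup'_lt_iff _).2 fun a ha => (Finset.lt_inf'_iff _).2 fun b hb =>
                hlt a ha b hb u h
            constructor
            · intro a ha
              have : f a u ≤ A.sup' ⟨a₀, ha₀⟩ (f · u) := Finset.le_sup' (f · u) ha
              linarith
            · intro b hb
              have : B.inf' ⟨b₀, hb₀⟩ (f · u) ≤ f b u := Finset.inf'_le (f · u) hb
              linarith
    · rcases lt_trichotomy y q with hy' | rfl | hy'
      · obtain ⟨m, hm₁, hm₂⟩ := Order.exists_between_finsets (A.image (f · y)) (B.image (f · y))
          (by simpa using fun a ha b hb => hlt a ha b hb y ⟨hy, hy'⟩)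
        refine const m ?_
        filter_upwards [ev y m (by simpa using hm₁) (by simpa using hm₂), gt_mem_nhds hy',
          lt_mem_nhds hy] with u hu h₁ h₂
        exact ⟨fun h => absurd h h₂.ne', fun h => absurd h h₁.ne, fun _ => hu⟩
      · refine const x ?_
        filter_upwards [ev y x hA hB, lt_mem_nhds hpq] with u hu huq
        exact ⟨fun h => absurd h huq.ne', fun _ => rfl, fun _ => hu⟩
      · refine const 0 ((lt_mem_nhds hy').mono fun u (hu : q < u) => ?_)
        exact ⟨fun h => absurd h (hpq.trans hu).ne', fun h => absurd h hu.ne',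
          fun h => absurd h.2 hu.not_gt⟩
  obtain ⟨g, hg⟩ := exists_continuous_forall_mem_convex_of_local ht H
  exact ⟨g, g.continuous, (hg p).1 rfl, (hg q).2.1 rfl, fun y hy => (hg y).2.2 hy⟩

/-- Finitely many reals can be separated by a real outside a given finite set. -/
theorem exists_between_finsets_notMem (A B C : Finset ℝ) (h : ∀ a ∈ A, ∀ b ∈ B, a < b) :
    ∃ m, (∀ a ∈ A, a < m) ∧ (∀ b ∈ B, m < b) ∧ m ∉ C := by
  obtain ⟨m, hA, hB⟩ := Order.exists_between_finsets A B h
  obtain ⟨m', h₁, h₂⟩ := Order.exists_between_finsets {m} (B ∪ C.filter (m < ·)) (by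
    simp only [Finset.mem_singleton, Finset.mem_union, Finset.mem_filter]
    rintro _ rfl b (hb | hb)
    exacts [hB b hb, hb.2])
  simp only [Finset.mem_singleton, forall_eq, Finset.mem_union, Finset.mem_filter] at h₁ h₂
  exact ⟨m', fun a ha => (hA a ha).trans h₁, fun b hb => h₂ b (.inl hb),
    fun hm => lt_irrefl _ (h₂ m' (.inr ⟨hm, h₁⟩))⟩

/-! ### Edges as graphs of functions of the height -/

namespace DirGraph.PlanarEmbedding

variable {V E : Type*} {G : DirGraph V E} {D : G.PlanarEmbedding}

/-- The height embeds the parameter interval as a closed subset of the line, so the horizontal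
coordinate is continuous on its image and extends by Tietze's theorem. -/
theorem IsUpward.exists_fn (hD : D.IsUpward) (e : E) :
    ∃ f : ℝ → ℝ, Continuous f ∧ ∀ t, (D.curve e t).1 = f (D.curve e t).2 := by
  have hc : Continuous fun t => (D.curve e t).2 := continuous_snd.comp (D.continuous_curve e)
  obtain ⟨f, hf⟩ := ContinuousMap.exists_extension' (hc.isClosedEmbedding (hD e).injective)
    (⟨fun t => (D.curve e t).1, continuous_fst.comp (D.continuous_curve e)⟩ : C(unitInterval, ℝ))
  exact ⟨f, f.continuous, fun t => (congrFun hf t).symm⟩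

/-- The horizontal coordinate of an edge of an upward drawing as a function of the height; outside
the range of heights of the edge its values are arbitrary. -/
noncomputable def IsUpward.fn (hD : D.IsUpward) (e : E) : ℝ → ℝ := (hD.exists_fn e).choose

theorem IsUpward.continuous_fn (hD : D.IsUpward) (e : E) : Continuous (hD.fn e) :=
  (hD.exists_fn e).choose_spec.1

theorem IsUpward.fst_curve (hD : D.IsUpward) (e : E) (t : unitInterval) :
    (D.curve e t).1 = hD.fn e (D.curve e t).2 :=
  (hD.exists_fn e).choose_spec.2 t

/-- The height of a vertex. -/
def ht (D : G.PlanarEmbedding) (x : V) : ℝ := (D.pos x).2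

theorem snd_curve_zero (D : G.PlanarEmbedding) (e : E) : (D.curve e 0).2 = D.ht (G.src e) := by
  rw [D.curve_zero, ht]

theorem snd_curve_one (D : G.PlanarEmbedding) (e : E) : (D.curve e 1).2 = D.ht (G.tgt e) := by
  rw [D.curve_one, ht]

theorem IsUpward.ht_src_lt (hD : D.IsUpward) (e : E) : D.ht (G.src e) < D.ht (G.tgt e) := by
  rw [← D.snd_curve_zero, ← D.snd_curve_one]
  exact hD e zero_lt_one

theorem IsUpward.snd_curve_mem (hD : D.IsUpward) (e : E) (t : unitInterval) :
    (D.curve e t).2 ∈ Icc (D.ht (G.src e)) (D.ht (G.tgt e)) := by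
  rw [← D.snd_curve_zero, ← D.snd_curve_one]
  exact ⟨(hD e).monotone unitInterval.nonneg', (hD e).monotone unitInterval.le_one'⟩

theorem IsUpward.snd_curve_mem_Ioo (hD : D.IsUpward) (e : E) {t : unitInterval}
    (ht : t ∈ Ioo 0 1) : (D.curve e t).2 ∈ Ioo (D.ht (G.src e)) (D.ht (G.tgt e)) := by
  rw [← D.snd_curve_zero, ← D.snd_curve_one]
  exact ⟨hD e ht.1, hD e ht.2⟩

theorem IsUpward.curve_eq (hD : D.IsUpward) (e : E) {t : unitInterval} {y : ℝ}
    (h : (D.curve e t).2 = y) : D.curve e t = (hD.fn e y, y) := by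
  subst h
  exact Prod.ext (hD.fst_curve e t) rfl

theorem IsUpward.exists_curve_eq (hD : D.IsUpward) (e : E) {y : ℝ}
    (hy : y ∈ Ioo (D.ht (G.src e)) (D.ht (G.tgt e))) :
    ∃ t ∈ Ioo (0 : unitInterval) 1, D.curve e t = (hD.fn e y, y) := by
  have hc : Continuous fun t => (D.curve e t).2 := continuous_snd.comp (D.continuous_curve e)
  rw [← D.snd_curve_zero, ← D.snd_curve_one] at hy
  obtain ⟨t, ht⟩ := intermediate_value_univ (0 : unitInterval) 1 hc (Ioo_subset_Icc_self hy)
  have ht : (D.curve e t).2 = y := ht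
  rw [← ht] at hy
  exact ⟨t, ⟨(hD e).lt_iff_lt.1 hy.1, (hD e).lt_iff_lt.1 hy.2⟩, hD.curve_eq e ht⟩

theorem IsUpward.pos_src (hD : D.IsUpward) (e : E) :
    D.pos (G.src e) = (hD.fn e (D.ht (G.src e)), D.ht (G.src e)) := by
  rw [← D.curve_zero]
  exact hD.curve_eq e (D.snd_curve_zero e)

theorem IsUpward.pos_tgt (hD : D.IsUpward) (e : E) :
    D.pos (G.tgt e) = (hD.fn e (D.ht (G.tgt e)), D.ht (G.tgt e)) := by
  rw [← D.curve_one]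
  exact hD.curve_eq e (D.snd_curve_one e)

theorem IsUpward.fn_ne_pos (hD : D.IsUpward) (e : E) {y : ℝ}
    (hy : y ∈ Ioo (D.ht (G.src e)) (D.ht (G.tgt e))) (x : V) : (hD.fn e y, y) ≠ D.pos x := by
  obtain ⟨t, ht, h⟩ := hD.exists_curve_eq e hy
  exact h ▸ D.curve_ne_pos e t ht x

theorem IsUpward.fn_ne_fn (hD : D.IsUpward) {e e' : E} (hne : e ≠ e') {y : ℝ}
    (hy : y ∈ Ioo (D.ht (G.src e)) (D.ht (G.tgt e)))
    (hy' : y ∈ Ioo (D.ht (G.src e')) (D.ht (G.tgt e'))) : hD.fn e y ≠ hD.fn e' y := by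
  intro h
  obtain ⟨t, ht, he⟩ := hD.exists_curve_eq e hy
  obtain ⟨t', ht', he'⟩ := hD.exists_curve_eq e' hy'
  exact D.curve_ne_curve e e' hne t ht t' ht' (by rw [he, he', h])

/-- Edges that meet below their upper ends start at the same vertex. -/
theorem IsUpward.src_eq_src (hD : D.IsUpward) {e e' : E} (hne : e ≠ e') {y : ℝ}
    (hy : y ∈ Ico (D.ht (G.src e)) (D.ht (G.tgt e)))
    (hy' : y ∈ Ico (D.ht (G.src e')) (D.ht (G.tgt e'))) (h : hD.fn e y = hD.fn e' y) :
    D.pos (G.src e) = (hD.fn e y, y) ∧ G.src e = G.src e' := by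
  rcases hy.1.eq_or_lt with h₁ | h₁ <;> rcases hy'.1.eq_or_lt with h₂ | h₂
  · have p₁ := hD.pos_src e
    have p₂ := hD.pos_src e'
    rw [h₁] at p₁
    rw [h₂, ← h] at p₂
    exact ⟨p₁, D.pos_injective (p₁.trans p₂.symm)⟩
  · have p₁ := hD.pos_src e
    rw [h₁, h] at p₁
    exact absurd p₁.symm (hD.fn_ne_pos e' ⟨h₂, hy'.2⟩ _)
  · have p₂ := hD.pos_src e'
    rw [h₂, ← h] at p₂
    exact absurd p₂.symm (hD.fn_ne_pos e ⟨h₁, hy.2⟩ _)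
  · exact absurd h (hD.fn_ne_fn hne ⟨h₁, hy.2⟩ ⟨h₂, hy'.2⟩)

/-- The order of two edges does not change along an interval of heights at which both are drawn. -/
theorem IsUpward.fn_lt_of_fn_lt (hD : D.IsUpward) {e e' : E} (hne : e ≠ e') {y z : ℝ}
    (hz : hD.fn e z < hD.fn e' z)
    (h : ∀ u ∈ uIcc y z, u = z ∨ u ∈ Ioo (D.ht (G.src e)) (D.ht (G.tgt e)) ∧
      u ∈ Ioo (D.ht (G.src e')) (D.ht (G.tgt e'))) : hD.fn e y < hD.fn e' y := by
  by_contra! hle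
  -- If the order changed, the functions would agree somewhere. This cannot happen at `z`, where the
  -- inequality is strict; so `z` may be an end of an edge.
  obtain ⟨u, hu, heq⟩ := isPreconnected_uIcc.intermediate_value₂ (right_mem_uIcc)
    (left_mem_uIcc (a := y) (b := z)) (hD.continuous_fn e).continuousOn
    (hD.continuous_fn e').continuousOn hz.le hle
  rcases h u hu with rfl | ⟨h₁, h₂⟩
  · exact hz.ne heq
  · exact hD.fn_ne_fn hne h₁ h₂ heq

/-! ### Descending paths that avoid the drawing -/

/-- A point outside the drawing. -/
def IsFree (D : G.PlanarEmbedding) (p : ℝ × ℝ) : Prop :=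
  (∀ v, D.pos v ≠ p) ∧ ∀ e, ∀ t ∈ Ioo (0 : unitInterval) 1, D.curve e t ≠ p

/-- A point that lies on no edge coming from below. -/
def IsFreeBelow (D : G.PlanarEmbedding) (hD : D.IsUpward) (x y : ℝ) : Prop :=
  ∀ e, y ∈ Ioc (D.ht (G.src e)) (D.ht (G.tgt e)) → hD.fn e y ≠ x

theorem isFree_of_fn_ne (hD : D.IsUpward) {x y : ℝ} (hv : ∀ v, D.pos v ≠ (x, y))
    (he : ∀ e, y ∈ Ioo (D.ht (G.src e)) (D.ht (G.tgt e)) → hD.fn e y ≠ x) : D.IsFree (x, y) := by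
  refine ⟨hv, fun e t ht h => ?_⟩
  have hy : (D.curve e t).2 = y := congrArg Prod.snd h
  have h₁ := hD.snd_curve_mem_Ioo e ht
  rw [hy] at h₁
  exact he e h₁ (congrArg Prod.fst ((hD.curve_eq e hy).symm.trans h))

theorem IsFree.isFreeBelow (hD : D.IsUpward) {x y : ℝ} (h : D.IsFree (x, y)) :
    D.IsFreeBelow hD x y := by
  rintro e he rfl
  rcases he.2.eq_or_lt with h' | h'
  · subst h'
    exact h.1 _ (hD.pos_tgt e)
  · obtain ⟨t, ht, hc⟩ := hD.exists_curve_eq e ⟨he.1, h'⟩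
    exact h.2 e t ht hc

/-- An edge reaching this point from below would end at the source or pass through it. Full freeness
fails here, since the point is itself a vertex. -/
theorem isFreeBelow_of_mem_sources (hD : D.IsUpward) {v : V} (hv : v ∈ G.sources) :
    D.IsFreeBelow hD (D.pos v).1 (D.ht v) := by
  intro e he hx
  have hpos : (hD.fn e (D.ht v), D.ht v) = D.pos v := by rw [hx]; rfl
  rcases he.2.eq_or_lt with hlt | hlt
  · rw [hlt, ← hD.pos_tgt] at hpos
    exact (Set.eq_empty_iff_forall_notMem.1 hv) e (D.pos_injective hpos)
  · exact hD.fn_ne_pos e ⟨he.1, hlt⟩ v hpos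

/-- From a point without edges below it, a path that avoids the drawing descends either to a given
level, or to a vertex that it reaches between two outgoing edges. -/
theorem exists_descending_path [Finite V] [Finite E] (hD : D.IsUpward) (c x h : ℝ)
    (hch : c < h) (hfree : D.IsFreeBelow hD x h) :
    ∃ (h₀ : ℝ) (g : ℝ → ℝ), c ≤ h₀ ∧ h₀ < h ∧ Continuous g ∧ g h = x ∧
      (∀ y ∈ Ioo h₀ h, D.IsFree (g y, y)) ∧
      ((h₀ = c ∧ D.IsFree (g h₀, h₀)) ∨
        ∃ w, D.pos w = (g h₀, h₀) ∧ ∃ a b, G.src a = w ∧ G.src b = w ∧ ∃ δ > 0,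
          ∀ y ∈ Ioo h₀ (h₀ + δ), hD.fn a y < g y ∧ g y < hD.fn b y) := by
  classical
  have := Fintype.ofFinite V
  have := Fintype.ofFinite E
  induction hn : (Finset.univ.filter fun v => D.ht v < h).card using Nat.strong_induction_on
    generalizing x h with
  | _ n ih =>
  -- `h'` is the larger of `c` and the greatest vertex height below `h`; no vertex lies strictly
  -- between the two levels.
  obtain ⟨h', hch', hh', hmax, hatt⟩ : ∃ h', c ≤ h' ∧ h' < h ∧ (∀ v, D.ht v < h → D.ht v ≤ h') ∧
      (h' = c ∨ ∃ v, D.ht v = h') := by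
    let s := insert c ((Finset.univ.filter fun v => D.ht v < h).image D.ht)
    have hs : s.Nonempty := ⟨c, Finset.mem_insert_self _ _⟩
    have hmem := s.max'_mem hs
    refine ⟨s.max' hs, s.le_max' _ (Finset.mem_insert_self _ _), ?_, fun v hv => s.le_max' _ ?_, ?_⟩
    · rcases Finset.mem_insert.1 hmem with h₁ | h₁
      · rwa [h₁]
      · obtain ⟨v, hv, hv'⟩ := Finset.mem_image.1 h₁
        rw [← hv']
        exact (Finset.mem_filter.1 hv).2
    · exact Finset.mem_insert_of_mem (Finset.mem_image_of_mem _ (by simpa using hv))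
    · rcases Finset.mem_insert.1 hmem with h₁ | h₁
      · exact .inl h₁
      · obtain ⟨v, hv, hv'⟩ := Finset.mem_image.1 h₁
        exact .inr ⟨v, hv'⟩
  let A := Finset.univ.filter fun e => h ∈ Ioc (D.ht (G.src e)) (D.ht (G.tgt e)) ∧ hD.fn e h < x
  let B := Finset.univ.filter fun e => h ∈ Ioc (D.ht (G.src e)) (D.ht (G.tgt e)) ∧ x < hD.fn e h
  have hA : ∀ a ∈ A, h ∈ Ioc (D.ht (G.src a)) (D.ht (G.tgt a)) ∧ hD.fn a h < x := by simp [A]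
  have hB : ∀ b ∈ B, h ∈ Ioc (D.ht (G.src b)) (D.ht (G.tgt b)) ∧ x < hD.fn b h := by simp [B]
  -- An edge drawn at or just above height `y` continues up to `h`, as there is no vertex height in
  -- between where it could end. So `A` and `B` contain all obstacles.
  have hact : ∀ e, ∀ y ∈ Ico h' h, y ∈ Ico (D.ht (G.src e)) (D.ht (G.tgt e)) → e ∈ A ∨ e ∈ B := by
    intro e y hy hye
    have h₁ : h ∈ Ioc (D.ht (G.src e)) (D.ht (G.tgt e)) := by
      refine ⟨hye.1.trans_lt hy.2, ?_⟩
      by_contra! hlt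
      exact (hmax _ hlt).not_gt (hy.1.trans_lt hye.2)
    rcases lt_or_gt_of_ne (hfree e h₁) with h₂ | h₂
    · exact .inl (by simpa [A] using ⟨h₁, h₂⟩)
    · exact .inr (by simpa [B] using ⟨h₁, h₂⟩)
  have hne : ∀ a ∈ A, ∀ b ∈ B, a ≠ b := by
    rintro a ha _ hb rfl
    exact lt_asymm (hA a ha).2 (hB a hb).2
  have hIoo : ∀ e, h ∈ Ioc (D.ht (G.src e)) (D.ht (G.tgt e)) → ∀ y ∈ Ioo h' h,
      y ∈ Ioo (D.ht (G.src e)) (D.ht (G.tgt e)) := fun e he y hy =>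
    ⟨(hmax _ he.1).trans_lt hy.1, hy.2.trans_le he.2⟩
  have hlt : ∀ a ∈ A, ∀ b ∈ B, ∀ y ∈ Ioo h' h, hD.fn a y < hD.fn b y := by
    intro a ha b hb y hy
    refine hD.fn_lt_of_fn_lt (hne a ha b hb) ((hA a ha).2.trans (hB b hb).2) fun u hu => ?_
    rw [uIcc_of_le hy.2.le] at hu
    rcases hu.2.eq_or_lt with h₁ | h₁
    · exact .inl h₁
    · have hu' : u ∈ Ioo h' h := ⟨hy.1.trans_le hu.1, h₁⟩
      exact .inr ⟨hIoo a (hA a ha).1 u hu', hIoo b (hB b hb).1 u hu'⟩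
  have hle : ∀ a ∈ A, ∀ b ∈ B, hD.fn a h' ≤ hD.fn b h' := by
    intro a ha b hb
    have hcl : h' ∈ closure (Ioo h' h) := by
      rw [closure_Ioo hh'.ne]
      exact left_mem_Icc.2 hh'.le
    exact closure_minimal (fun y hy => (hlt a ha b hb y hy).le)
      (isClosed_le (hD.continuous_fn a) (hD.continuous_fn b)) hcl
  have hpath : ∀ g : ℝ → ℝ, (∀ y ∈ Ioo h' h, (∀ a ∈ A, hD.fn a y < g y) ∧
      ∀ b ∈ B, g y < hD.fn b y) → ∀ y ∈ Ioo h' h, D.IsFree (g y, y) := by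
    intro g hg y hy
    refine isFree_of_fn_ne hD (fun v hv => ?_) fun e he => ?_
    · have hv' : D.ht v = y := congrArg Prod.snd hv
      exact (hmax v (hv'.trans_lt hy.2)).not_gt (hy.1.trans_eq hv'.symm)
    · rcases hact e y ⟨hy.1.le, hy.2⟩ ⟨he.1.le, he.2⟩ with h₁ | h₁
      · exact ((hg y hy).1 e h₁).ne
      · exact ((hg y hy).2 e h₁).ne'
  -- The channel closes at `h'` exactly when a left and a right edge meet there; their common
  -- starting vertex is then the end of the path.
  by_cases htouch : ∃ a ∈ A, ∃ b ∈ B, hD.fn a h' = hD.fn b h'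
  · obtain ⟨a, ha, b, hb, hab⟩ := htouch
    obtain ⟨g, hgc, hg', hg, hgb⟩ := exists_continuous_between A B hD.fn hD.continuous_fn
      (x := x) (x' := hD.fn a h') hh' hlt (fun a ha => (hA a ha).2) (fun b hb => (hB b hb).2)
      (.inr ⟨⟨a, ha, rfl⟩, ⟨b, hb, hab.symm⟩, hle⟩)
    obtain ⟨hw, hsrc⟩ := hD.src_eq_src (hne a ha b hb)
      ⟨hmax _ (hA a ha).1.1, hh'.trans_le (hA a ha).1.2⟩
      ⟨hmax _ (hB b hb).1.1, hh'.trans_le (hB b hb).1.2⟩ hab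
    refine ⟨h', g, hch', hh', hgc, hg, hpath g hgb, .inr ⟨G.src a, by rw [hw, hg'], a, b, rfl,
      hsrc.symm, h - h', sub_pos.2 hh', fun y hy => ?_⟩⟩
    rw [add_sub_cancel] at hy
    exact ⟨(hgb y hy).1 a ha, (hgb y hy).2 b hb⟩
  · push Not at htouch
    -- The open channel may contain vertices at height `h'`, necessarily without outgoing edges; the
    -- path must miss them.
    obtain ⟨x', hx'A, hx'B, hx'⟩ := exists_between_finsets_notMem (A.image (hD.fn · h'))
      (B.image (hD.fn · h')) (Finset.univ.image fun v => (D.pos v).1) (by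
        simpa using fun a ha b hb => lt_of_le_of_ne (hle a ha b hb) (htouch a ha b hb))
    simp only [Finset.mem_image, forall_exists_index, and_imp, forall_apply_eq_imp_iff₂] at hx'A hx'B
    obtain ⟨g, hgc, hg', hg, hgb⟩ := exists_continuous_between A B hD.fn hD.continuous_fn
      (x := x) (x' := x') hh' hlt (fun a ha => (hA a ha).2) (fun b hb => (hB b hb).2)
      (.inl ⟨hx'A, hx'B⟩)
    have hx'v : ∀ v, D.pos v ≠ (x', h') := fun v hv =>
      hx' (Finset.mem_image.2 ⟨v, Finset.mem_univ _, by rw [hv]⟩)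
    have hfree' : D.IsFree (x', h') := by
      refine isFree_of_fn_ne hD hx'v fun e he => ?_
      rcases hact e h' ⟨le_rfl, hh'⟩ ⟨he.1.le, he.2⟩ with h₁ | h₁
      · exact (hx'A e h₁).ne
      · exact (hx'B e h₁).ne'
    rcases hch'.eq_or_lt with rfl | hlt'
    · exact ⟨c, g, le_rfl, hh', hgc, hg, hpath g hgb, .inl ⟨rfl, by rwa [hg']⟩⟩
    · obtain ⟨v₀, hv₀⟩ := hatt.resolve_left hlt'.ne'
      -- The count of vertices below the starting level drops, since `v₀` has height exactly `h'`.
      obtain ⟨h₀, g₀, hch₀, hh₀, hg₀c, hg₀, hg₀f, hend⟩ := ih _ (by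
        rw [← hn]
        apply Finset.card_lt_card
        rw [Finset.ssubset_iff_of_subset (Finset.monotone_filter_right _
          fun v _ (hv : D.ht v < h') => hv.trans hh')]
        exact ⟨v₀, by simpa [hv₀] using hh', by simp [hv₀]⟩) x' h' hlt' (hfree'.isFreeBelow hD) rfl
      let k : ℝ → ℝ := fun y => if y ≤ h' then g₀ y else g y
      have hk₀ : ∀ y ≤ h', k y = g₀ y := fun y hy => if_pos hy
      have hk₁ : ∀ y, h' < y → k y = g y := fun y hy => if_neg hy.not_ge
      refine ⟨h₀, k, hch₀, hh₀.trans hh', ?_, by rw [hk₁ h hh', hg], fun y hy => ?_, ?_⟩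
      · exact hg₀c.if_le hgc continuous_id continuous_const (by rintro y rfl; exact hg₀.trans hg'.symm)
      · rcases lt_trichotomy y h' with h₁ | rfl | h₁
        · rw [hk₀ y h₁.le]
          exact hg₀f y ⟨hy.1, h₁⟩
        · rwa [hk₀ y le_rfl, hg₀]
        · rw [hk₁ y h₁]
          exact hpath g hgb y ⟨h₁, hy.2⟩
      · rw [hk₀ h₀ hh₀.le]
        refine hend.imp id ?_
        rintro ⟨w, hw, a, b, ha, hb, δ, hδ, hab⟩
        refine ⟨w, hw, a, b, ha, hb, min δ (h' - h₀), lt_min hδ (sub_pos.2 hh₀), fun y hy => ?_⟩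
        rw [hk₀ y (by linarith [hy.2, min_le_right δ (h' - h₀)])]
        exact hab y ⟨hy.1, hy.2.trans_le (by linarith [min_le_left δ (h' - h₀)])⟩

end DirGraph.PlanarEmbedding

/-! ### Adding vertices and edges, reflection -/

namespace DirGraph

variable {V E : Type*}

/-- Adds an isolated vertex. -/
def addVertex (G : DirGraph V E) : DirGraph (Option V) E where
  src e := some (G.src e)
  tgt e := some (G.tgt e)

/-- Adds an edge from `a` to `b`. -/
def addEdge (G : DirGraph V E) (a b : V) : DirGraph V (Option E) where
  src o := o.elim a G.src
  tgt o := o.elim b G.tgt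

/-- Reverses all edges. -/
def reverse (G : DirGraph V E) : DirGraph V E where
  src := G.tgt
  tgt := G.src

namespace PlanarEmbedding

variable {G : DirGraph V E} {D : G.PlanarEmbedding}

/-- Heights increase along directed paths. Hence extended drawings need no separate check of
acyclicity. -/
theorem IsUpward.acyclic (hD : D.IsUpward) : G.Acyclic := by
  intro x hx
  have key : ∀ y, Relation.TransGen (fun a b => ∃ e, G.src e = a ∧ G.tgt e = b) x y →
      D.ht x < D.ht y := by
    intro y hy
    induction hy with
    | single h =>
      obtain ⟨e, rfl, rfl⟩ := h
      exact hD.ht_src_lt e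
    | tail _ h ih =>
      obtain ⟨e, rfl, rfl⟩ := h
      exact ih.trans (hD.ht_src_lt e)
  exact lt_irrefl _ (key x hx)

/-- Draws an additional isolated vertex at a point outside the drawing. -/
def addVertex (D : G.PlanarEmbedding) (p : ℝ × ℝ) (hp : D.IsFree p) :
    G.addVertex.PlanarEmbedding where
  pos o := o.elim p D.pos
  curve := D.curve
  pos_injective := by
    rintro (_ | x) (_ | y) h
    · rfl
    · exact absurd h.symm (hp.1 y)
    · exact absurd h (hp.1 x)
    · exact congrArg some (D.pos_injective h)
  continuous_curve := D.continuous_curve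
  curve_zero := D.curve_zero
  curve_one := D.curve_one
  injOn_curve := D.injOn_curve
  curve_ne_pos := by
    rintro e t ht (_ | x)
    · exact hp.2 e t ht
    · exact D.curve_ne_pos e t ht x
  curve_ne_curve := D.curve_ne_curve

/-- The height at the parameter `t` of a curve that ascends from `p` to `q` at constant speed. -/
noncomputable def ramp (p q : ℝ) (t : unitInterval) : ℝ := p + t * (q - p)

theorem continuous_ramp (p q : ℝ) : Continuous (ramp p q) := by
  unfold ramp
  fun_prop

theorem strictMono_ramp {p q : ℝ} (h : p < q) : StrictMono (ramp p q) := by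
  intro s t hst
  have hst : (s : ℝ) < t := hst
  have := mul_lt_mul_of_pos_right hst (sub_pos.2 h)
  simpa [ramp] using this

theorem ramp_zero (p q : ℝ) : ramp p q 0 = p := by simp [ramp]

theorem ramp_one (p q : ℝ) : ramp p q 1 = q := by simp [ramp]

theorem ramp_mem_Ioo {p q : ℝ} (h : p < q) {t : unitInterval} (ht : t ∈ Ioo 0 1) :
    ramp p q t ∈ Ioo p q := by
  have h₀ := strictMono_ramp h ht.1
  have h₁ := strictMono_ramp h ht.2
  rw [ramp_zero] at h₀
  rw [ramp_one] at h₁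
  exact ⟨h₀, h₁⟩

/-- Draws an additional edge, the graph of a function of the height that avoids the drawing. -/
noncomputable def addEdge (D : G.PlanarEmbedding) (a b : V) (hab : D.ht a < D.ht b)
    (g : ℝ → ℝ) (hg : Continuous g) (ha : g (D.ht a) = (D.pos a).1)
    (hb : g (D.ht b) = (D.pos b).1) (hfree : ∀ y ∈ Ioo (D.ht a) (D.ht b), D.IsFree (g y, y)) :
    (G.addEdge a b).PlanarEmbedding where
  pos := D.pos
  curve o t := o.elim (g (ramp (D.ht a) (D.ht b) t), ramp (D.ht a) (D.ht b) t) fun e => D.curve e t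
  pos_injective := D.pos_injective
  continuous_curve := by
    rintro (_ | e)
    · have := continuous_ramp (D.ht a) (D.ht b)
      exact (hg.comp this).prodMk this
    · exact D.continuous_curve e
  curve_zero := by
    rintro (_ | e)
    · simp only [Option.elim, ramp_zero, ha]
      rfl
    · exact D.curve_zero e
  curve_one := by
    rintro (_ | e)
    · simp only [Option.elim, ramp_one, hb]
      rfl
    · exact D.curve_one e
  injOn_curve := by
    rintro (_ | e)
    · exact fun s _ t _ h => (strictMono_ramp hab).injective (congrArg Prod.snd h)
    · exact D.injOn_curve e
  curve_ne_pos := by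
    rintro (_ | e) t ht x
    · exact ((hfree _ (ramp_mem_Ioo hab ht)).1 x).symm
    · exact D.curve_ne_pos e t ht x
  curve_ne_curve := by
    rintro (_ | e) (_ | e') hne t ht t' ht'
    · exact absurd rfl hne
    · exact ((hfree _ (ramp_mem_Ioo hab ht)).2 e' t' ht').symm
    · exact (hfree _ (ramp_mem_Ioo hab ht')).2 e t ht
    · exact D.curve_ne_curve e e' (fun h => hne (congrArg some h)) t ht t' ht'

theorem IsUpward.addEdge (hD : D.IsUpward) {a b : V} (hab : D.ht a < D.ht b) {g : ℝ → ℝ}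
    (hg : Continuous g) (ha : g (D.ht a) = (D.pos a).1) (hb : g (D.ht b) = (D.pos b).1)
    (hfree : ∀ y ∈ Ioo (D.ht a) (D.ht b), D.IsFree (g y, y)) :
    (D.addEdge a b hab g hg ha hb hfree).IsUpward := by
  rintro (_ | e)
  · exact strictMono_ramp hab
  · exact hD e

theorem IsUpward.addVertex (hD : D.IsUpward) {p : ℝ × ℝ} (hp : D.IsFree p) :
    (D.addVertex p hp).IsUpward := hD

/-- The reflection of the plane in the horizontal axis. -/
def mirror (p : ℝ × ℝ) : ℝ × ℝ := (p.1, -p.2)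

theorem mirror_mirror (p : ℝ × ℝ) : mirror (mirror p) = p := by simp [mirror]

theorem mirror_injective : Function.Injective mirror :=
  Function.LeftInverse.injective mirror_mirror

theorem symm_mem_Ioo {t : unitInterval} (ht : t ∈ Ioo 0 1) : unitInterval.symm t ∈ Ioo 0 1 := by
  constructor
  · rw [← unitInterval.symm_one]
    exact unitInterval.symm_lt_symm.2 ht.2
  · rw [← unitInterval.symm_zero]
    exact unitInterval.symm_lt_symm.2 ht.1

/-- The mirror image of a drawing in a horizontal line. -/
def reflect (D : G.PlanarEmbedding) : G.reverse.PlanarEmbedding where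
  pos x := mirror (D.pos x)
  curve e t := mirror (D.curve e (unitInterval.symm t))
  pos_injective := mirror_injective.comp D.pos_injective
  continuous_curve e := by
    have := D.continuous_curve e
    unfold mirror
    fun_prop
  curve_zero e := by
    rw [unitInterval.symm_zero, D.curve_one]
    rfl
  curve_one e := by
    rw [unitInterval.symm_one, D.curve_zero]
    rfl
  injOn_curve e s hs t ht h := unitInterval.symm_bijective.injective
    (D.injOn_curve e (symm_mem_Ioo hs) (symm_mem_Ioo ht) (mirror_injective h))
  curve_ne_pos e t ht x h := D.curve_ne_pos e _ (symm_mem_Ioo ht) x (mirror_injective h)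
  curve_ne_curve e e' hne t ht t' ht' h :=
    D.curve_ne_curve e e' hne _ (symm_mem_Ioo ht) _ (symm_mem_Ioo ht') (mirror_injective h)

theorem IsUpward.reflect (hD : D.IsUpward) : D.reflect.IsUpward := by
  intro e s t hst
  exact neg_lt_neg (hD e (unitInterval.symm_lt_symm.2 hst))

theorem inLt_reflect (D : G.PlanarEmbedding) (x : V) (e e' : E) :
    D.reflect.inLt x e e' ↔ D.outLt x e e' := by
  refine and_congr Iff.rfl (and_congr Iff.rfl (exists_congr fun δ => and_congr Iff.rfl
    ⟨fun h t t' he hm => ?_, fun h t t' he hm => ?_⟩))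
  · have := h (unitInterval.symm t) (unitInterval.symm t')
    simp only [reflect, mirror, unitInterval.symm_symm, neg_inj, mem_Ioo] at this
    exact this he ⟨by linarith [hm.2], by linarith [hm.1]⟩
  · simp only [reflect, mirror, neg_inj, mem_Ioo] at he hm ⊢
    exact h _ _ he ⟨by linarith [hm.2], by linarith [hm.1]⟩

theorem outLt_reflect (D : G.PlanarEmbedding) (x : V) (e e' : E) :
    D.reflect.outLt x e e' ↔ D.inLt x e e' := by
  refine and_congr Iff.rfl (and_congr Iff.rfl (exists_congr fun δ => and_congr Iff.rfl
    ⟨fun h t t' he hm => ?_, fun h t t' he hm => ?_⟩))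
  · have := h (unitInterval.symm t) (unitInterval.symm t')
    simp only [reflect, mirror, unitInterval.symm_symm, neg_inj, mem_Ioo] at this
    exact this he ⟨by linarith [hm.2], by linarith [hm.1]⟩
  · simp only [reflect, mirror, neg_inj, mem_Ioo] at he hm ⊢
    exact h _ _ he ⟨by linarith [hm.2], by linarith [hm.1]⟩

/-! ### The polarization -/

/-- The edges cannot cross between `x` and their upper ends, so one comparison at height `y` decides
the order all the way down to `x`. -/
theorem IsUpward.outLt_of_fn_lt (hD : D.IsUpward) {x : V} {e e' : E} (he : e ∈ G.outEdges x)
    (he' : e' ∈ G.outEdges x) {y : ℝ} (hy : D.ht x < y) (hye : y < D.ht (G.tgt e))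
    (hye' : y < D.ht (G.tgt e')) (h : hD.fn e y < hD.fn e' y) : D.outLt x e e' := by
  refine ⟨he, he', y - D.ht x, sub_pos.2 hy, fun t t' htt hm => ?_⟩
  change _ ∈ Ioo (D.ht x) (D.ht x + _) at hm
  rw [add_sub_cancel] at hm
  rw [hD.fst_curve, hD.fst_curve, ← htt]
  refine hD.fn_lt_of_fn_lt (by rintro rfl; exact lt_irrefl _ h) h fun u hu => .inr ?_
  rw [uIcc_of_le hm.2.le] at hu
  rw [he.out, he'.out]
  exact ⟨⟨hm.1.trans_le hu.1, hu.2.trans_lt hye⟩, ⟨hm.1.trans_le hu.1, hu.2.trans_lt hye'⟩⟩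

/-- An outgoing edge between two others is strictly inside the order of the polarization. -/
theorem IsUpward.strictlyInside_outLt [Finite E] (hD : D.IsUpward) {x : V} {e m M : E}
    (hm : D.outLt x m e) (hM : D.outLt x e M) : StrictlyInside (D.outLt x) (G.outEdges x) e := by
  classical
  have := Fintype.ofFinite E
  -- A height above `x` and below the upper ends of all outgoing edges: the horizontal positions
  -- there represent the whole order on `O(x)`.
  obtain ⟨y, hy, hy'⟩ := Order.exists_between_finsets {D.ht x}
    ((Finset.univ.filter (· ∈ G.outEdges x)).image fun e => D.ht (G.tgt e)) (by
      simp only [Finset.mem_singleton, Finset.mem_image, Finset.mem_filter, Finset.mem_univ,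
        true_and, forall_eq, forall_exists_index, and_imp, forall_apply_eq_imp_iff₂]
      intro f hf
      rw [← hf.out]
      exact hD.ht_src_lt f)
  simp only [Finset.mem_singleton, Finset.mem_image, Finset.mem_filter, Finset.mem_univ,
    true_and, forall_eq, forall_exists_index, and_imp, forall_apply_eq_imp_iff₂] at hy hy'
  have hIoo : ∀ f ∈ G.outEdges x, y ∈ Ioo (D.ht (G.src f)) (D.ht (G.tgt f)) := fun f hf =>
    ⟨by rwa [hf.out], hy' f hf⟩
  have hlt : ∀ f ∈ G.outEdges x, ∀ f' ∈ G.outEdges x, f ≠ f' → hD.fn f y ≤ hD.fn f' y →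
      D.outLt x f f' := fun f hf f' hf' hne hle => hD.outLt_of_fn_lt hf hf' hy (hy' f hf) (hy' f' hf')
    (lt_of_le_of_ne hle (hD.fn_ne_fn hne (hIoo f hf) (hIoo f' hf')))
  -- Compare the edges at a height `u` close to `x`, then carry the order up to `y`.
  have hasymm : ∀ f f', D.outLt x f f' → hD.fn f y < hD.fn f' y := by
    rintro f f' ⟨hf, hf', δ, hδ, h⟩
    obtain ⟨u, hu₁, hu₂⟩ := exists_between (lt_min hy (lt_add_of_pos_right (D.ht x) hδ))
    have hu : ∀ f ∈ G.outEdges x, ∀ z, D.ht x < z → z ≤ y →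
        z ∈ Ioo (D.ht (G.src f)) (D.ht (G.tgt f)) := fun f hf z hz hzy =>
      ⟨by rwa [hf.out], hzy.trans_lt (hy' f hf)⟩
    have huy : u ≤ y := hu₂.le.trans (min_le_left _ _)
    obtain ⟨t, -, ht⟩ := hD.exists_curve_eq f (hu f hf u hu₁ huy)
    obtain ⟨t', -, ht'⟩ := hD.exists_curve_eq f' (hu f' hf' u hu₁ huy)
    have hlt := h t t' (by rw [ht, ht']) (by
      rw [ht]
      exact ⟨hu₁, hu₂.trans_le (min_le_right _ _)⟩)
    rw [ht, ht'] at hlt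
    refine hD.fn_lt_of_fn_lt (by rintro rfl; exact lt_irrefl _ hlt) hlt fun z hz => .inr ?_
    rw [uIcc_of_ge huy] at hz
    exact ⟨hu f hf z (hu₁.trans_le hz.1) hz.2, hu f' hf' z (hu₁.trans_le hz.1) hz.2⟩
  obtain ⟨m₀, hm₀, hmin⟩ := (G.outEdges x).exists_min_image (hD.fn · y) (toFinite _) ⟨e, hM.1⟩
  obtain ⟨M₀, hM₀, hmax⟩ := (G.outEdges x).exists_max_image (hD.fn · y) (toFinite _) ⟨e, hM.1⟩
  refine ⟨m₀, M₀, ⟨hm₀, fun f hf hne => hlt _ hm₀ _ hf hne.symm (hmin f hf)⟩,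
    ⟨hM₀, fun f hf hne => hlt _ hf _ hM₀ hne (hmax f hf)⟩, ?_, ?_⟩
  · refine hlt _ hm₀ _ hM.1 ?_ (hmin e hM.1)
    rintro rfl
    exact (hmin m hm.1).not_gt (hasymm _ _ hm)
  · refine hlt _ hM.1 _ hM₀ ?_ (hmax e hM.1)
    rintro rfl
    exact (hmax M hM.2.1).not_gt (hasymm _ _ hM)

/-- An incoming edge between two others is strictly inside the order of the polarization. -/
theorem IsUpward.strictlyInside_inLt [Finite E] (hD : D.IsUpward) {x : V} {e m M : E}
    (hm : D.inLt x m e) (hM : D.inLt x e M) : StrictlyInside (D.inLt x) (G.inEdges x) e := by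
  simpa only [StrictlyInside, outLt_reflect] using! hD.reflect.strictlyInside_outLt
    ((D.outLt_reflect x m e).2 hm) ((D.outLt_reflect x e M).2 hM)

end PlanarEmbedding

end DirGraph

/-! ### Embeddings that extend drawings -/

namespace DirGraph

theorem mem_sources {V E : Type*} {G : DirGraph V E} {x : V} :
    x ∈ G.sources ↔ ∀ e, G.tgt e ≠ x :=
  Set.eq_empty_iff_forall_notMem

theorem mem_sinks {V E : Type*} {G : DirGraph V E} {x : V} : x ∈ G.sinks ↔ ∀ e, G.src e ≠ x :=
  Set.eq_empty_iff_forall_notMem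

namespace Embedding

variable {V E W F X Y : Type*} {G : DirGraph V E} {H : DirGraph W F} {K : DirGraph X Y}

/-- The composition of two embeddings. -/
def trans (φ : G.Embedding H) (ψ : H.Embedding K) : G.Embedding K where
  onVert := φ.onVert.trans ψ.onVert
  onEdge := φ.onEdge.trans ψ.onEdge
  src_onEdge e := by simp [ψ.src_onEdge, φ.src_onEdge]
  tgt_onEdge e := by simp [ψ.tgt_onEdge, φ.tgt_onEdge]

/-- The drawing of the larger graph extends that of the smaller one. -/
structure Extends (φ : G.Embedding H) (D : G.PlanarEmbedding) (D' : H.PlanarEmbedding) : Prop where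
  pos_eq : ∀ x, D'.pos (φ.onVert x) = D.pos x
  curve_eq : ∀ e, D'.curve (φ.onEdge e) = D.curve e

theorem Extends.trans {φ : G.Embedding H} {ψ : H.Embedding K} {D : G.PlanarEmbedding}
    {D' : H.PlanarEmbedding} {D'' : K.PlanarEmbedding} (h : φ.Extends D D')
    (h' : ψ.Extends D' D'') : (φ.trans ψ).Extends D D'' where
  pos_eq x := (h'.pos_eq _).trans (h.pos_eq x)
  curve_eq e := (h'.curve_eq _).trans (h.curve_eq e)

theorem Extends.outLt {φ : G.Embedding H} {D : G.PlanarEmbedding} {D' : H.PlanarEmbedding}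
    (h : φ.Extends D D') {x : V} {e e' : E} (hlt : D.outLt x e e') :
    D'.outLt (φ.onVert x) (φ.onEdge e) (φ.onEdge e') := by
  obtain ⟨he, he', hδ⟩ := hlt
  refine ⟨(φ.src_onEdge e).trans (congrArg _ he), (φ.src_onEdge e').trans (congrArg _ he'), ?_⟩
  rwa [h.curve_eq, h.curve_eq, h.pos_eq]

end Embedding

end DirGraph

/-! ### Completion below the sources -/

namespace UpwardPlanarGraph

open DirGraph

/-- A source of an upward planar graph at a height above `c` can be given an incoming edge, that
comes either from a vertex, where it leaves between two edges, or from a new vertex at height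
`c`. -/
theorem exists_addIncoming {W : Type u} {F : Type v} [Finite W] [Finite F]
    (Γ : UpwardPlanarGraph W F) {c : ℝ} {v : W} (hv : v ∈ Γ.graph.sources)
    (hcv : c < (Γ.drawing.pos v).2) :
    ∃ (W' : Type u) (F' : Type v) (_ : Finite W') (_ : Finite F') (Γ' : UpwardPlanarGraph W' F')
      (ι : Γ.graph.Embedding Γ'.graph) (f : F'),
      ι.Extends Γ.drawing Γ'.drawing ∧ f ∉ range ι.onEdge ∧ (∀ f', f' = f ∨ f' ∈ range ι.onEdge) ∧
      Nat.card F' = Nat.card F + 1 ∧ Γ'.graph.tgt f = ι.onVert v ∧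
      ((∀ w', w' ∈ range ι.onVert) ∧ (∃ w, Γ'.graph.src f = ι.onVert w ∧
          ∃ m M, m ≠ M ∧ Γ.graph.src m = w ∧ Γ.graph.src M = w ∧
            Γ'.drawing.outLt (Γ'.graph.src f) (ι.onEdge m) f ∧
            Γ'.drawing.outLt (Γ'.graph.src f) f (ι.onEdge M)) ∨
        Γ'.graph.src f ∉ range ι.onVert ∧ (Γ'.drawing.pos (Γ'.graph.src f)).2 = c ∧
          ∀ w', w' = Γ'.graph.src f ∨ w' ∈ range ι.onVert) := by
  have hD := Γ.upward
  obtain ⟨h₀, g, hch₀, hh₀, hg, hgv, hfree, hend⟩ := PlanarEmbedding.exists_descending_path hD c _ _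
    hcv (PlanarEmbedding.isFreeBelow_of_mem_sources hD hv)
  rcases hend with ⟨rfl, hc⟩ | ⟨w, hw, a, b, ha, hb, δ, hδ, hab⟩
  · have hD' := hD.addVertex hc
    let D' := Γ.drawing.addVertex _ hc
    -- The new vertex is the lower end of the path, so its height is below all heights considered
    -- here.
    have hfree' : ∀ y ∈ Ioo (D'.ht none) (D'.ht (some v)), D'.IsFree (g y, y) := by
      intro y hy
      refine ⟨?_, (hfree y hy).2⟩
      rintro (_ | x)
      · exact fun h => hy.1.ne (congrArg Prod.snd h)
      · exact (hfree y hy).1 x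
    have hup := hD'.addEdge (a := none) (b := some v) hh₀ hg rfl hgv hfree'
    refine ⟨Option W, Option F, inferInstance, inferInstance, ⟨_, hup.acyclic, _, hup⟩,
      ⟨.some, .some, fun _ => rfl, fun _ => rfl⟩, none, ⟨fun _ => rfl, fun _ => rfl⟩, by simp, ?_,
      Finite.card_option, rfl, .inr ⟨by simp [DirGraph.addEdge], rfl, ?_⟩⟩
    · rintro (_ | f)
      exacts [.inl rfl, .inr ⟨f, rfl⟩]
    · rintro (_ | x)
      exacts [.inl rfl, .inr ⟨x, rfl⟩]
  · obtain rfl : Γ.drawing.ht w = h₀ := congrArg Prod.snd hw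
    have hgw : g (Γ.drawing.ht w) = (Γ.drawing.pos w).1 := (congrArg Prod.fst hw).symm
    have hup := hD.addEdge hh₀ hg hgw hgv hfree
    refine ⟨W, Option F, inferInstance, inferInstance, ⟨_, hup.acyclic, _, hup⟩,
      ⟨.refl _, .some, fun _ => rfl, fun _ => rfl⟩, none, ⟨fun _ => rfl, fun _ => rfl⟩, by simp, ?_,
      Finite.card_option, rfl, .inl ⟨fun x => ⟨x, rfl⟩, w, rfl, a, b, ?_, ha, hb, ?_, ?_⟩⟩
    · rintro (_ | f)
      exacts [.inl rfl, .inr ⟨f, rfl⟩]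
    · rintro rfl
      obtain ⟨y, hy⟩ := nonempty_Ioo.2 (lt_add_of_pos_right (Γ.drawing.ht w) hδ)
      exact lt_asymm (hab y hy).1 (hab y hy).2
    · refine ⟨ha, rfl, δ, hδ, fun t t' h hm => ?_⟩
      change (Γ.drawing.curve a t).1 < g (PlanarEmbedding.ramp _ _ t')
      change (Γ.drawing.curve a t).2 = PlanarEmbedding.ramp _ _ t' at h
      rw [← h, hD.fst_curve]
      exact (hab _ hm).1
    · refine ⟨rfl, hb, δ, hδ, fun t t' h hm => ?_⟩
      change g (PlanarEmbedding.ramp _ _ t) < (Γ.drawing.curve b t').1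
      change PlanarEmbedding.ramp _ _ t = (Γ.drawing.curve b t').2 at h
      rw [hD.fst_curve, ← h]
      exact (hab _ hm).2

/-- `Γ` arises from `G` by giving each source in `S` an incoming edge, either from an additional
vertex at height `c` or from a vertex with several outgoing edges in `G`, where it leaves between
two edges. -/
structure DownCompletion {V E W F : Type*} (G : UpwardPlanarGraph V E) (c : ℝ) (S : Set V)
    (Γ : UpwardPlanarGraph W F) (φ : G.graph.Embedding Γ.graph) : Prop where
  ext : φ.Extends G.drawing Γ.drawing
  ht_new : ∀ w ∉ range φ.onVert, (Γ.drawing.pos w).2 = c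
  tgt_ne_new : ∀ w ∉ range φ.onVert, ∀ f, Γ.graph.tgt f ≠ w
  existsUnique_src_eq_new : ∀ w ∉ range φ.onVert, ∃! f, Γ.graph.src f = w
  existsUnique_tgt_eq : ∀ x ∈ S, ∃! f, Γ.graph.tgt f = φ.onVert x
  tgt_new : ∀ f ∉ range φ.onEdge, ∃ x ∈ S, Γ.graph.tgt f = φ.onVert x
  src_new : ∀ f ∉ range φ.onEdge, Γ.graph.src f ∉ range φ.onVert ∨
    (∃ a b, a ≠ b ∧ Γ.graph.src f = φ.onVert (G.graph.src a) ∧ G.graph.src b = G.graph.src a) ∧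
      ∃ m M, Γ.drawing.outLt (Γ.graph.src f) m f ∧ Γ.drawing.outLt (Γ.graph.src f) f M
  card_edges : Nat.card F = Nat.card E + S.ncard

/-- The added edges end only at members of `S`, so `x` is still a source of `Γ` and can receive an
edge. Most fields are inherited; the point is that the new edge leaves either a new vertex or one
that had two outgoing edges already in `G`. -/
theorem DownCompletion.exists_insert {V : Type*} {E : Type*} [Finite V] {G : UpwardPlanarGraph V E}
    {c : ℝ} {S : Set V} {W : Type u} {F : Type v} [Finite W] [Finite F] {Γ : UpwardPlanarGraph W F}
    {φ : G.graph.Embedding Γ.graph} (h : DownCompletion G c S Γ φ) {x : V} (hxS : x ∉ S)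
    (hx : x ∈ G.graph.sources) (hcx : c < (G.drawing.pos x).2) :
    ∃ (W' : Type u) (F' : Type v) (_ : Finite W') (_ : Finite F') (Γ' : UpwardPlanarGraph W' F')
      (φ' : G.graph.Embedding Γ'.graph), DownCompletion G c (insert x S) Γ' φ' := by
  have hv : φ.onVert x ∈ Γ.graph.sources := by
    rw [mem_sources] at hx ⊢
    intro f hf
    by_cases hfr : f ∈ range φ.onEdge
    · obtain ⟨e, rfl⟩ := hfr
      rw [φ.tgt_onEdge] at hf
      exact hx e (φ.onVert.injective hf)
    · obtain ⟨x', hx', he⟩ := h.tgt_new f hfr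
      exact hxS (φ.onVert.injective (hf.symm.trans he) ▸ hx')
  obtain ⟨W', F', _, _, Γ', ι, f, hι, hf, hF, hcard, htgt, hsrc⟩ :=
    Γ.exists_addIncoming (c := c) hv (by rwa [h.ext.pos_eq])
  have hr : ∀ {w}, ι.onVert w ∉ range (φ.trans ι).onVert → w ∉ range φ.onVert := by
    rintro _ hw ⟨y, rfl⟩
    exact hw ⟨y, rfl⟩
  have hr' : ∀ {w}, w ∉ range φ.onVert → ι.onVert w ∉ range (φ.trans ι).onVert := by
    rintro w hw ⟨y, hy⟩
    exact hw ⟨y, ι.onVert.injective hy⟩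
  have hold : ∀ f', f' ∉ range (φ.trans ι).onEdge →
      f' = f ∨ ∃ f₁ ∉ range φ.onEdge, ι.onEdge f₁ = f' := by
    intro f' hf'
    refine (hF f').imp id ?_
    rintro ⟨f₁, rfl⟩
    refine ⟨f₁, ?_, rfl⟩
    rintro ⟨e, rfl⟩
    exact hf' ⟨e, rfl⟩
  refine ⟨W', F', ‹_›, ‹_›, Γ', φ.trans ι, h.ext.trans hι, ?_, ?_, ?_, ?_, ?_, ?_, ?_⟩
  · intro w' hw'
    by_cases hw : w' ∈ range ι.onVert
    · obtain ⟨w, rfl⟩ := hw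
      rw [hι.pos_eq]
      exact h.ht_new w (hr hw')
    · rcases hsrc with ⟨hall, -⟩ | ⟨-, hc, hall⟩
      · exact absurd (hall w') hw
      · rw [(hall w').resolve_right hw, hc]
  · rintro w' hw' f' rfl
    rcases hF f' with rfl | ⟨f₁, rfl⟩
    · exact hw' ⟨x, htgt.symm⟩
    · rw [ι.tgt_onEdge] at hw'
      exact h.tgt_ne_new _ (hr hw') f₁ rfl
  · intro w' hw'
    by_cases hw : w' ∈ range ι.onVert
    · obtain ⟨w, rfl⟩ := hw
      obtain ⟨f₁, hf₁, huniq⟩ := h.existsUnique_src_eq_new w (hr hw')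
      refine ⟨ι.onEdge f₁, (ι.src_onEdge f₁).trans (congrArg _ hf₁), fun f' hf' => ?_⟩
      rcases hF f' with rfl | ⟨f₂, rfl⟩
      · exfalso
        -- A path never ends at an earlier new vertex: this has a single outgoing edge, and a path
        -- ends between two.
        rcases hsrc with ⟨-, w₀, hw₀, m, M, hmM, hm, hM, -⟩ | ⟨hnr, -⟩
        · obtain rfl : w₀ = w := ι.onVert.injective (hw₀.symm.trans hf')
          exact hmM ((huniq m hm).trans (huniq M hM).symm)
        · exact hnr ⟨w, hf'.symm⟩
      · exact congrArg _ (huniq f₂ (ι.onVert.injective ((ι.src_onEdge f₂).symm.trans hf')))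
    · rcases hsrc with ⟨hall, -⟩ | ⟨-, -, hall⟩
      · exact absurd (hall w') hw
      · refine ⟨f, ((hall w').resolve_right hw).symm, fun f' hf' => (hF f').resolve_right ?_⟩
        rintro ⟨f₂, rfl⟩
        exact hw ⟨_, (ι.src_onEdge f₂).symm.trans hf'⟩
  · rintro y (rfl | hy)
    · refine ⟨f, htgt, fun f' hf' => (hF f').resolve_right ?_⟩
      rintro ⟨f₂, rfl⟩
      exact mem_sources.1 hv f₂ (ι.onVert.injective ((ι.tgt_onEdge f₂).symm.trans hf'))
    · obtain ⟨f₁, hf₁, huniq⟩ := h.existsUnique_tgt_eq y hy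
      refine ⟨ι.onEdge f₁, (ι.tgt_onEdge f₁).trans (congrArg _ hf₁), fun f' hf' => ?_⟩
      rcases hF f' with rfl | ⟨f₂, rfl⟩
      · exact absurd ((φ.trans ι).onVert.injective (htgt.symm.trans hf') ▸ hy) hxS
      · exact congrArg _ (huniq f₂ (ι.onVert.injective ((ι.tgt_onEdge f₂).symm.trans hf')))
  · intro f' hf'
    rcases hold f' hf' with rfl | ⟨f₁, hf₁, rfl⟩
    · exact ⟨x, mem_insert _ _, htgt⟩
    · obtain ⟨y, hy, he⟩ := h.tgt_new f₁ hf₁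
      exact ⟨y, mem_insert_of_mem _ hy, (ι.tgt_onEdge f₁).trans (congrArg _ he)⟩
  · intro f' hf'
    rcases hold f' hf' with rfl | ⟨f₁, hf₁, rfl⟩
    · rcases hsrc with ⟨-, w₀, hw₀, m, M, hmM, hm, hM, hlt⟩ | ⟨hnr, -⟩
      · have hw₀r : w₀ ∈ range φ.onVert := by
          by_contra hnr
          obtain ⟨f₁, -, huniq⟩ := h.existsUnique_src_eq_new w₀ hnr
          exact hmM ((huniq m hm).trans (huniq M hM).symm)
        refine .inr ⟨?_, _, _, hlt⟩
        -- If one of the neighbouring edges was itself added earlier, its own `src_new` supplies two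
        -- edges of `G` at the same vertex.
        have hnew : ∀ k ∉ range φ.onEdge, Γ.graph.src k = w₀ → ∃ a b, a ≠ b ∧
            Γ'.graph.src f' = (φ.trans ι).onVert (G.graph.src a) ∧
            G.graph.src b = G.graph.src a := by
          intro k hk hkw
          obtain ⟨⟨a, b, hab, ha, hb⟩, -⟩ := (h.src_new k hk).resolve_left fun hn =>
            hn (hkw ▸ hw₀r)
          exact ⟨a, b, hab, hw₀.trans (congrArg _ (hkw.symm.trans ha)), hb⟩
        by_cases hmr : m ∈ range φ.onEdge
        · by_cases hMr : M ∈ range φ.onEdge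
          · obtain ⟨a, rfl⟩ := hmr
            obtain ⟨b, rfl⟩ := hMr
            rw [φ.src_onEdge] at hm hM
            exact ⟨a, b, fun hab => hmM (congrArg _ hab), hw₀.trans (congrArg _ hm.symm),
              φ.onVert.injective (hM.trans hm.symm)⟩
          · exact hnew M hMr hM
        · exact hnew m hmr hm
      · refine .inl ?_
        rintro ⟨y, hy⟩
        exact hnr ⟨φ.onVert y, hy⟩
    · rw [ι.src_onEdge]
      refine (h.src_new f₁ hf₁).imp hr' ?_
      rintro ⟨⟨a, b, hab, ha, hb⟩, m, M, hm, hM⟩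
      exact ⟨⟨a, b, hab, congrArg _ ha, hb⟩, _, _, hι.outLt hm, hι.outLt hM⟩
  · rw [hcard, h.card_edges, ncard_insert_of_notMem hxS, add_assoc]

theorem exists_downCompletion {V : Type u} {E : Type v} [Finite V] [Finite E]
    (G : UpwardPlanarGraph V E) {c : ℝ} {S : Set V} (hS : S ⊆ G.graph.sources)
    (hc : ∀ x ∈ S, c < (G.drawing.pos x).2) :
    ∃ (W : Type u) (F : Type v) (_ : Finite W) (_ : Finite F) (Γ : UpwardPlanarGraph W F)
      (φ : G.graph.Embedding Γ.graph), DownCompletion G c S Γ φ := by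
  induction S, S.toFinite using Set.Finite.induction_on with
  | empty =>
    exact ⟨V, E, ‹_›, ‹_›, G, ⟨.refl _, .refl _, fun _ => rfl, fun _ => rfl⟩,
      ⟨⟨fun _ => rfl, fun _ => rfl⟩, fun w hw => absurd ⟨w, rfl⟩ hw, fun w hw => absurd ⟨w, rfl⟩ hw,
      fun w hw => absurd ⟨w, rfl⟩ hw, fun x hx => hx.elim, fun f hf => absurd ⟨f, rfl⟩ hf,
      fun f hf => absurd ⟨f, rfl⟩ hf, by simp⟩⟩
  | @insert x S hxS _ ih =>
    obtain ⟨W, F, _, _, Γ, φ, h⟩ := ih ((subset_insert _ _).trans hS)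
      fun x hx => hc x (mem_insert_of_mem _ hx)
    exact h.exists_insert hxS (hS (mem_insert _ _)) (hc x (mem_insert _ _))

end UpwardPlanarGraph

/-! ### Transfer to mirror images, bounding boxes -/

open DirGraph

/-- An embedding of a reversed graph, seen as an embedding into a reversed graph. -/
def DirGraph.Embedding.ofReverse {V E W F : Type*} {G : DirGraph V E} {H : DirGraph W F}
    (φ : G.reverse.Embedding H) : G.Embedding H.reverse where
  onVert := φ.onVert
  onEdge := φ.onEdge
  src_onEdge := φ.tgt_onEdge
  tgt_onEdge := φ.src_onEdge

theorem DirGraph.Embedding.Extends.ofReverse {V E W F : Type*} {G : DirGraph V E}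
    {H : DirGraph W F} {φ : G.reverse.Embedding H} {D : G.PlanarEmbedding} {D' : H.PlanarEmbedding}
    (h : φ.Extends D.reflect D') : φ.ofReverse.Extends D D'.reflect where
  pos_eq x := (congrArg PlanarEmbedding.mirror (h.pos_eq x)).trans
    (PlanarEmbedding.mirror_mirror _)
  curve_eq e := by
    funext t
    refine (congrArg PlanarEmbedding.mirror
      (congrFun (h.curve_eq e) (unitInterval.symm t))).trans ?_
    simp only [PlanarEmbedding.reflect, PlanarEmbedding.mirror_mirror, unitInterval.symm_symm]

namespace DirGraph.PlanarEmbedding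

theorem exists_horizontal_bounds {V E : Type*} [Finite V] [Finite E] {G : DirGraph V E}
    (D : G.PlanarEmbedding) : ∃ a b : ℝ, a < b ∧ (∀ x, (D.pos x).1 ∈ Icc a b) ∧
      ∀ e t, (D.curve e t).1 ∈ Icc a b := by
  have hK : IsCompact (range (fun x => (D.pos x).1) ∪ ⋃ e, range fun t => (D.curve e t).1) :=
    (finite_range _).isCompact.union (isCompact_iUnion fun e =>
      isCompact_range (continuous_fst.comp (D.continuous_curve e)))
  obtain ⟨a, ha⟩ := hK.bddBelow
  obtain ⟨b, hb⟩ := hK.bddAbove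
  have key : ∀ z ∈ range (fun x => (D.pos x).1) ∪ ⋃ e, range fun t => (D.curve e t).1,
      -- For the empty graph the two bounds are unrelated; minimum, maximum and the shift by one
      -- make the box nondegenerate.
      z ∈ Icc (min a b - 1) (max a b) := fun z hz =>
    ⟨by linarith [ha hz, min_le_left a b], (hb hz).trans (le_max_right _ _)⟩
  refine ⟨min a b - 1, max a b, by linarith [min_le_max (a := a) (b := b)],
    fun x => key _ (.inl ⟨x, rfl⟩), fun e t => key _ (.inr (mem_iUnion.2 ⟨e, t, rfl⟩))⟩

theorem IsUpward.isBoxed {V E : Type*} [Finite V] [Finite E] {G : DirGraph V E}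
    {D : G.PlanarEmbedding} (hD : D.IsUpward) {c d : ℝ} (hcd : c < d)
    (h : ∀ x, D.ht x ∈ Icc c d) (hc : ∀ x ∈ G.sources, D.ht x = c)
    (hd : ∀ x ∈ G.sinks, D.ht x = d) : D.IsBoxed := by
  obtain ⟨a, b, hab, hpos, hcurve⟩ := D.exists_horizontal_bounds
  refine ⟨a, b, c, d, hab, hcd, fun x => ⟨hpos x, h x⟩, fun e t => ⟨hcurve e t, ?_⟩, hc, hd⟩
  have := hD.snd_curve_mem e t
  exact ⟨(h _).1.trans this.1, this.2.trans (h _).2⟩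

theorem exists_vertical_bounds {V E : Type*} [Finite V] {G : DirGraph V E}
    (D : G.PlanarEmbedding) : ∃ c d : ℝ, c < d ∧ ∀ x, D.ht x ∈ Ioo c d := by
  obtain ⟨c, hc⟩ := (finite_range D.ht).bddBelow
  obtain ⟨d, hd⟩ := (finite_range D.ht).bddAbove
  refine ⟨min c d - 1, max c d + 1, by linarith [min_le_max (a := c) (b := d)], fun x => ⟨?_, ?_⟩⟩
  · linarith [hc ⟨x, rfl⟩, min_le_left c d]
  · linarith [hd ⟨x, rfl⟩, le_max_right c d]

end DirGraph.PlanarEmbedding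

/-! ### Sources, sinks and degrees of a completion -/

namespace UpwardPlanarGraph

/-- The mirror image of an upward planar graph in a horizontal line. -/
def reflect {V E : Type*} (G : UpwardPlanarGraph V E) : UpwardPlanarGraph V E where
  graph := G.graph.reverse
  acyclic := G.upward.reflect.acyclic
  drawing := G.drawing.reflect
  upward := G.upward.reflect

namespace DownCompletion

variable {V E W F : Type*} {G : UpwardPlanarGraph V E} {c : ℝ} {S : Set V}
  {Γ : UpwardPlanarGraph W F} {φ : G.graph.Embedding Γ.graph}

/-- New vertices have an outgoing edge, and added edges leave only new vertices or vertices that had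
outgoing edges before. -/
theorem sinks_eq (h : DownCompletion G c S Γ φ) :
    Γ.graph.sinks = Set.image φ.onVert G.graph.sinks := by
  ext w
  constructor
  · intro hw
    have hwr : w ∈ range φ.onVert := by
      by_contra hnr
      obtain ⟨f, hf, -⟩ := h.existsUnique_src_eq_new w hnr
      exact mem_sinks.1 hw f hf
    obtain ⟨x, rfl⟩ := hwr
    exact ⟨x, mem_sinks.2 fun e he => mem_sinks.1 hw (φ.onEdge e) (by rw [φ.src_onEdge, he]), rfl⟩
  · rintro ⟨x, hx, rfl⟩
    refine mem_sinks.2 fun f hf => ?_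
    by_cases hfr : f ∈ range φ.onEdge
    · obtain ⟨e, rfl⟩ := hfr
      exact mem_sinks.1 hx e (φ.onVert.injective ((φ.src_onEdge e).symm.trans hf))
    · rcases h.src_new f hfr with hnr | ⟨⟨a, b, -, ha, -⟩, -⟩
      · exact hnr ⟨x, hf.symm⟩
      · exact mem_sinks.1 hx a (φ.onVert.injective (ha.symm.trans hf))

theorem sources_eq (h : DownCompletion G c G.graph.sources Γ φ) :
    Γ.graph.sources = (range φ.onVert)ᶜ := by
  ext w
  constructor
  · rintro hw ⟨x, rfl⟩
    by_cases hx : x ∈ G.graph.sources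
    · obtain ⟨f, hf, -⟩ := h.existsUnique_tgt_eq x hx
      exact mem_sources.1 hw f hf
    · refine hx (mem_sources.2 fun e he => mem_sources.1 hw (φ.onEdge e) ?_)
      rw [φ.tgt_onEdge, he]
  · exact fun hw => mem_sources.2 (h.tgt_ne_new w hw)

theorem degree_eq_one_of_notMem_range (h : DownCompletion G c S Γ φ) {w : W}
    (hw : w ∉ range φ.onVert) : Γ.graph.degree w = 1 := by
  have hin : Γ.graph.inEdges w = ∅ := mem_sources.2 (h.tgt_ne_new w hw)
  obtain ⟨f, hf, huniq⟩ := h.existsUnique_src_eq_new w hw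
  have hout : Γ.graph.outEdges w = {f} := by
    ext f'
    exact ⟨huniq f', fun h' => h'.symm ▸ hf⟩
  simp [DirGraph.degree, hin, hout]

/-- Added edges end only in `S`. Applied to the mirror image, this shows that the second round
leaves the degree of the bottom vertices at one. -/
theorem inEdges_onVert (h : DownCompletion G c S Γ φ) (x : V) (hx : x ∉ S) :
    Γ.graph.inEdges (φ.onVert x) = Set.image φ.onEdge (G.graph.inEdges x) := by
  ext f
  constructor
  · intro hf
    by_cases hfr : f ∈ range φ.onEdge
    · obtain ⟨e, rfl⟩ := hfr
      exact ⟨e, φ.onVert.injective ((φ.tgt_onEdge e).symm.trans hf), rfl⟩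
    · obtain ⟨y, hy, he⟩ := h.tgt_new f hfr
      exact absurd (φ.onVert.injective (he.symm.trans hf) ▸ hy) hx
  · rintro ⟨e, rfl, rfl⟩
    exact φ.tgt_onEdge e

end DownCompletion

end UpwardPlanarGraph

theorem DirGraph.degree_reverse {V E : Type*} (G : DirGraph V E) (x : V) :
    G.reverse.degree x = G.degree x :=
  add_comm _ _

/-! ### The two completions combined -/

theorem mainTheorem6 {V : Type u} {E : Type v} [Finite V] [Finite E]
    (G : UpwardPlanarGraph V E) :
    ∃ (W : Type u) (F : Type v) (_ : Finite W) (_ : Finite F)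
      (Γ : ProgressivePlaneGraph W F) (φ : G.graph.Embedding Γ.graph),
      -- the drawing of `G` is part of the drawing of `Γ`
      (∀ x, Γ.drawing.pos (φ.onVert x) = G.drawing.pos x) ∧
      (∀ e, Γ.drawing.curve (φ.onEdge e) = G.drawing.curve e) ∧
      -- (1)
      Set.range φ.onVert = Set.univ \ (Γ.graph.sources ∪ Γ.graph.sinks) ∧
      -- (2)
      Nat.card F = Nat.card E + G.graph.sources.ncard + G.graph.sinks.ncard ∧
      -- (3)
      (∀ x ∈ G.graph.sources, ∀ y ∈ G.graph.sinks,
        Γ.graph.inEdges (φ.onVert x) ∩ Γ.graph.outEdges (φ.onVert y) = ∅) ∧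
      -- (4)
      (∀ e, e ∉ Set.range φ.onEdge ∪ Γ.graph.inputEdges ∪ Γ.graph.outputEdges →
        StrictlyInside (Γ.drawing.outLt (Γ.graph.src e))
            (Γ.graph.outEdges (Γ.graph.src e)) e ∨
          StrictlyInside (Γ.drawing.inLt (Γ.graph.tgt e))
            (Γ.graph.inEdges (Γ.graph.tgt e)) e) := by
  obtain ⟨c, d, hcd, hbd⟩ := G.drawing.exists_vertical_bounds
  obtain ⟨W₁, F₁, _, _, Γ₁, φ, hφ⟩ := G.exists_downCompletion (c := c) subset_rfl
    fun x _ => (hbd x).1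
  have hsinks₁ : ∀ w ∈ Γ₁.graph.sinks, Γ₁.drawing.ht w < d := by
    intro w hw
    rw [hφ.sinks_eq] at hw
    obtain ⟨x, -, rfl⟩ := hw
    exact (congrArg Prod.snd (hφ.ext.pos_eq x)).trans_lt (hbd x).2
  -- The second round works in the mirror image, where sinks are sources and the top level `d`
  -- becomes `-d`; `Γ₂.reflect` is the final drawing.
  obtain ⟨W₂, F₂, _, _, Γ₂, ψ, hψ⟩ := Γ₁.reflect.exists_downCompletion (c := -d)
    (S := Γ₁.reflect.graph.sources) subset_rfl fun w hw => neg_lt_neg (hsinks₁ w hw)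
  have hext := hψ.ext.ofReverse
  have hsrc : Γ₂.reflect.graph.sources = Set.image ψ.onVert (range φ.onVert)ᶜ :=
    hψ.sinks_eq.trans (congrArg _ hφ.sources_eq)
  have hsink : Γ₂.reflect.graph.sinks = (range ψ.onVert)ᶜ := hψ.sources_eq
  have hposψ : ∀ w, Γ₂.reflect.drawing.ht (ψ.onVert w) = Γ₁.drawing.ht w := fun w =>
    congrArg Prod.snd (hext.pos_eq w)
  have hht : ∀ x ∈ Γ₂.reflect.graph.sources, Γ₂.reflect.drawing.ht x = c := by
    rw [hsrc]
    rintro _ ⟨w, hw, rfl⟩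
    rw [hposψ]
    exact hφ.ht_new w hw
  have hht' : ∀ x ∈ Γ₂.reflect.graph.sinks, Γ₂.reflect.drawing.ht x = d := by
    rw [hsink]
    intro w hw
    exact (congrArg Neg.neg (hψ.ht_new w hw)).trans (neg_neg d)
  have hprog : Γ₂.reflect.graph.IsProgressive := by
    refine ⟨Γ₂.reflect.acyclic, ?_, ?_⟩
    · rw [hsrc]
      rintro _ ⟨w, hw, rfl⟩
      rw [← hφ.degree_eq_one_of_notMem_range hw]
      have hw' : w ∈ Γ₁.graph.sources := hφ.sources_eq ▸ hw
      have hin : Γ₂.reflect.graph.inEdges (ψ.onVert w) = ∅ := by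
        change ψ.onVert w ∈ Γ₂.reflect.graph.sources
        rw [hsrc]
        exact ⟨w, hw, rfl⟩
      have hout : Γ₂.reflect.graph.outEdges (ψ.onVert w) =
          Set.image ψ.onEdge (Γ₁.graph.outEdges w) := by
        refine hψ.inEdges_onVert w fun hs => ?_
        have hs : w ∈ Γ₁.graph.sinks := hs
        rw [hφ.sinks_eq] at hs
        exact hw (image_subset_range _ _ hs)
      have hin' : Γ₁.graph.inEdges w = ∅ := hw'
      rw [DirGraph.degree, DirGraph.degree, hin, hout, hin', ncard_empty, ncard_empty,
        ncard_image_of_injective _ ψ.onEdge.injective]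
    · rw [hsink]
      intro w hw
      exact (DirGraph.degree_reverse _ _).trans (hψ.degree_eq_one_of_notMem_range hw)
  have hbox : Γ₂.reflect.drawing.IsBoxed := by
    refine Γ₂.reflect.upward.isBoxed hcd (fun w => ?_) hht hht'
    by_cases hw : w ∈ range ψ.onVert
    · obtain ⟨w, rfl⟩ := hw
      by_cases hw : w ∈ range φ.onVert
      · obtain ⟨x, rfl⟩ := hw
        rw [hposψ, show Γ₁.drawing.ht _ = G.drawing.ht x from
          congrArg Prod.snd (hφ.ext.pos_eq x)]
        exact Ioo_subset_Icc_self (hbd x)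
      · rw [hht _ (hsrc ▸ ⟨w, hw, rfl⟩)]
        exact left_mem_Icc.2 hcd.le
    · rw [hht' _ (hsink ▸ hw)]
      exact right_mem_Icc.2 hcd.le
  have hext' := hφ.ext.trans hext
  refine ⟨W₂, F₂, ‹_›, ‹_›, ⟨Γ₂.reflect.graph, hprog, Γ₂.reflect.drawing, Γ₂.reflect.upward, hbox⟩,
    φ.trans ψ.ofReverse, hext'.pos_eq, hext'.curve_eq, ?_, ?_, ?_, ?_⟩
  · dsimp only
    rw [hsrc, hsink]
    ext w
    constructor
    · rintro ⟨x, rfl⟩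
      refine ⟨mem_univ _, ?_⟩
      rintro (⟨w, hw, he⟩ | hn)
      · exact hw ⟨x, (ψ.onVert.injective he).symm⟩
      · exact hn ⟨φ.onVert x, rfl⟩
    · rintro ⟨-, hw⟩
      rw [mem_union, not_or, notMem_compl_iff] at hw
      obtain ⟨hw, w, rfl⟩ := hw
      by_contra hn
      refine hw ⟨w, ?_, rfl⟩
      rintro ⟨x, rfl⟩
      exact hn ⟨x, rfl⟩
  · have hS : (Γ₁.reflect.graph.sources).ncard = G.graph.sinks.ncard := by
      change Γ₁.graph.sinks.ncard = _
      rw [hφ.sinks_eq, ncard_image_of_injective _ φ.onVert.injective]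
    rw [hψ.card_edges, hφ.card_edges, hS]
  · intro x hx y hy
    refine Set.eq_empty_iff_forall_notMem.2 ?_
    rintro f ⟨hfx, hfy⟩
    have hfx : Γ₂.graph.src f = ψ.onVert (φ.onVert x) := hfx
    have hfy : Γ₂.graph.tgt f = ψ.onVert (φ.onVert y) := hfy
    -- An edge from the first round or from `G` would start at a vertex that is still a sink of
    -- `Γ₁`. An edge of the second round would need two incoming edges of `Γ₁` at a source of `G`,
    -- which has only one.
    by_cases hf : f ∈ range ψ.onEdge
    · obtain ⟨f, rfl⟩ := hf
      have hfy : Γ₁.graph.src f = φ.onVert y :=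
        ψ.onVert.injective ((ψ.tgt_onEdge f).symm.trans hfy)
      refine mem_sinks.1 ?_ f hfy
      rw [hφ.sinks_eq]
      exact ⟨y, hy, rfl⟩
    · obtain ⟨⟨a, b, hab, ha, hb⟩, -⟩ := (hψ.src_new f hf).resolve_left fun hn => hn ⟨_, hfx.symm⟩
      have ha : Γ₁.graph.tgt a = φ.onVert x := ψ.onVert.injective (ha.symm.trans hfx)
      have hb : Γ₁.graph.tgt b = φ.onVert x := Eq.trans hb ha
      exact hab ((hφ.existsUnique_tgt_eq x hx).unique ha hb)
  · intro f hf
    rw [mem_union, mem_union, not_or, not_or] at hf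
    obtain ⟨⟨hfr, hfi⟩, hfo⟩ := hf
    -- Edges added in the first round lie between outgoing edges, and this persists in the extended
    -- drawing; those of the second lie between incoming edges.
    by_cases hf : f ∈ range ψ.onEdge
    · obtain ⟨f, rfl⟩ := hf
      have hfr' : f ∉ range φ.onEdge := by
        rintro ⟨e, rfl⟩
        exact hfr ⟨e, rfl⟩
      have hs : Γ₂.reflect.graph.src (ψ.onEdge f) = ψ.onVert (Γ₁.graph.src f) :=
        ψ.tgt_onEdge f
      rcases hφ.src_new f hfr' with hn | ⟨-, m, M, hm, hM⟩
      · refine absurd ?_ hfi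
        change Γ₂.reflect.graph.src (ψ.onEdge f) ∈ Γ₂.reflect.graph.sources
        rw [hs, hsrc]
        exact ⟨_, hn, rfl⟩
      · left
        dsimp only
        rw [hs]
        exact Γ₂.reflect.upward.strictlyInside_outLt (hext.outLt hm) (hext.outLt hM)
    · rcases hψ.src_new f hf with hn | ⟨-, m, M, hm, hM⟩
      · refine absurd ?_ hfo
        change Γ₂.reflect.graph.tgt f ∈ Γ₂.reflect.graph.sinks
        rw [hsink]
        exact hn
      · exact .inr (Γ₂.reflect.upward.strictlyInside_inLt
          ((Γ₂.drawing.inLt_reflect _ _ _).2 hm) ((Γ₂.drawing.inLt_reflect _ _ _).2 hM))
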